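/- \textbf{Theorem (Pareto frontier for the linear search game).} \emph{Game.} A Hider is at an unknown point $y\in\mathbb{R}\setminus\{0\}$. A pure Searcher strategy is a bi-infinite sequence $S=(x_i,\tau_i)_{i\in\mathbb{Z}}$ with $x_i>0$, $x_i<x_{i+2}$ and alternating directions $\tau_i\in\{\text{left},\text{right}\}$: in iteration $i$ the Searcher starts at the origin, explores the half-line $\tau_i$ to distance $x_i$ and returns to the origin. If $j$ is the first iteration that reaches $y$ (i.e. $\tau_j$ is the side of $y$ and $x_j\ge|y|$), the cost is $c(S,y)=|y|+2\sum_{i<j}x_i\in[0,\infty]$; if there is no first such iteration, $c(S,y)=\infty$. The payoff is $u(S,y)=c(S,y)/|y|$. A mixed strategy $s$ is a probability distribution over pure strategies, and $u(s,y)$ is the expected payoff. The prediction is that $y>0$. The consistency and robustness of $s$ are \[ C(s)=\sup_{y>0}u(s,y),\qquad R(s)=\sup_{y\neq 0}u(s,y). \] A mixed strategy $s$ is Pareto optimal if there is no mixed strategy $s'$ with $C(s')\le C(s)$ and $R(s')\le R(s)$, at least one of these inequalities being strict. The Pareto frontier $P$ is the set of pairs $(C(s),R(s))$ over all Pareto optimal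 mixed strategies $s$. For $\alpha>1$ and $\mu\in(0,1]$ let $s_{\alpha,\mu}$ be the mixed strategy in which $u$ is uniform on $[0,2]$, even iterations $i$ search the right half-line to $x_i=\alpha^{i+u}$, and odd iterations $i$ search the left half-line to $x_i=\mu\,\alpha^{i+u}$. \emph{Claim.} For every $\lambda\in(0,1]$ the function \[ f_\lambda(\alpha)=1+\lambda+\frac{1+\lambda+2\sqrt{\lambda}\,\alpha}{\ln\alpha},\qquad \alpha>1, \] has a unique minimizer $\bar\alpha=\bar\alpha(\lambda)$. With $\mu=\sqrt{\lambda}$, \[ P=\left\{\left(1+\frac{1+\mu\bar\alpha}{\ln\bar\alpha},\;1+\frac{1+\bar\alpha/\mu}{\ln\bar\alpha}\right):\lambda\in(0,1]\right\}. \] Moreover, for every $\lambda\in(0,1]$ the strategy $s_{\bar\alpha,\mu}$ is Pareto optimal, with consistency exactly $1+\frac{1+\mu\bar\alpha}{\ln\bar\alpha}$ and robustness exactly $1+\frac{1+\bar\alpha/\mu}{\ln\bar\alpha}$. -/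

import Mathlib

open MeasureTheory Set
open scoped ENNReal

namespace LinearSearch

/-- A pure Searcher strategy: in iteration `i` the Searcher starts at the origin, explores the
half-line with direction `dir i` (`true` is right, `false` is left) to distance `x i`, and returns
to the origin. -/
structure PureStrategy where
  x : ℤ → ℝ
  dir : ℤ → Bool
  x_pos : ∀ i, 0 < x i
  dir_alternates : ∀ i, dir (i + 1) ≠ dir i
  x_strict : ∀ i, x i < x (i + 2)

/-- The σ-algebra generated by the coordinates `x i` and `dir i`. -/
instance : MeasurableSpace PureStrategy :=
  MeasurableSpace.comap (fun S => (S.x, S.dir)) inferInstance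

/-- Mixed Searcher strategies. -/
abbrev MixedStrategy : Type := ProbabilityMeasure PureStrategy

/-- Iteration `i` of `S` reaches the point `y ≠ 0`. -/
def PureStrategy.Reaches (S : PureStrategy) (i : ℤ) (y : ℝ) : Prop :=
  ((S.dir i = true ∧ 0 < y) ∨ (S.dir i = false ∧ y < 0)) ∧ |y| ≤ S.x i

/-- The cost at which `S` locates `y`: if `j` is the first iteration that reaches `y`, it is
`|y| + 2 ∑_{i < j} x i` (possibly `∞`); if there is no first such iteration, it is `∞`, the value
of the infimum over the empty set. -/
noncomputable def cost (S : PureStrategy) (y : ℝ) : ℝ≥0∞ :=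
  ⨅ j : ℤ, ⨅ _ : IsLeast {i : ℤ | S.Reaches i y} j,
    (ENNReal.ofReal |y| + 2 * ∑' i : Set.Iio j, ENNReal.ofReal (S.x i))

/-- The normalized cost of a pure strategy. -/
noncomputable def payoff (S : PureStrategy) (y : ℝ) : ℝ≥0∞ :=
  cost S y / ENNReal.ofReal |y|

/-- The expected normalized cost of a mixed strategy. -/
noncomputable def expectedPayoff (s : MixedStrategy) (y : ℝ) : ℝ≥0∞ :=
  ∫⁻ S, payoff S y ∂(s : Measure PureStrategy)

/-- Worst case over the predicted (positive) half-line. -/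
noncomputable def consistency (s : MixedStrategy) : ℝ≥0∞ :=
  ⨆ y ∈ {y : ℝ | 0 < y}, expectedPayoff s y

/-- Worst case over all Hider positions (the competitive ratio). -/
noncomputable def robustness (s : MixedStrategy) : ℝ≥0∞ :=
  ⨆ y ∈ {y : ℝ | y ≠ 0}, expectedPayoff s y

/-- No mixed strategy is at least as good in both criteria and strictly better in one. -/
def ParetoOptimal (s : MixedStrategy) : Prop :=
  ¬ ∃ s' : MixedStrategy, consistency s' ≤ consistency s ∧ robustness s' ≤ robustness s ∧
    (consistency s' < consistency s ∨ robustness s' < robustness s)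

/-- The pairs (consistency, robustness) of the Pareto optimal mixed strategies. -/
def paretoFrontier : Set (ℝ≥0∞ × ℝ≥0∞) :=
  {p | ∃ s : MixedStrategy, ParetoOptimal s ∧ p = (consistency s, robustness s)}

/-- The biased geometric strategy with base `α`, bias `μ` and offset `u`: even iterations search
the right half-line to distance `α ^ (i + u)`, odd iterations search the left half-line to distance
`μ * α ^ (i + u)`. -/
noncomputable def geometricPure (α μ : ℝ) (hα : 1 < α) (hμ : 0 < μ) (u : ℝ) : PureStrategy where
  x i := if Even i then α ^ ((i : ℝ) + u) else μ * α ^ ((i : ℝ) + u)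
  dir i := decide (Even i)
  x_pos i := by
    have h : 0 < α ^ ((i : ℝ) + u) := Real.rpow_pos_of_pos (by linarith) _
    split_ifs
    · exact h
    · exact mul_pos hμ h
  dir_alternates i := by
    by_cases h : Even i <;> simp [h]
  x_strict i := by
    have h : α ^ ((i : ℝ) + u) < α ^ (((i + 2 : ℤ) : ℝ) + u) :=
      Real.rpow_lt_rpow_of_exponent_lt hα (by push_cast; linarith)
    have he : Even (i + 2) ↔ Even i := by
      rw [Int.even_add]; simp
    simp only [he]
    split_ifs
    · exact h
    · exact mul_lt_mul_of_pos_left h hμ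

theorem measurable_geometricPure (α μ : ℝ) (hα : 1 < α) (hμ : 0 < μ) :
    Measurable (geometricPure α μ hα hμ) := by
  have hα0 : α ≠ 0 := by linarith
  refine Measurable.of_comap_le ?_
  change MeasurableSpace.comap _ (MeasurableSpace.comap _ _) ≤ _
  rw [MeasurableSpace.comap_comp, ← measurable_iff_comap_le]
  refine Measurable.prodMk (measurable_pi_lambda _ fun i => ?_) measurable_const
  have h : Measurable fun u : ℝ => α ^ ((i : ℝ) + u) :=
    (Real.continuous_const_rpow hα0).measurable.comp (measurable_const.add measurable_id)
  by_cases hi : Even i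
  · simpa [geometricPure, hi] using h
  · simpa [geometricPure, hi] using h.const_mul μ

/-- The uniform distribution on `[0, 2]`. -/
noncomputable def uniformOffset : ProbabilityMeasure ℝ :=
  ⟨ProbabilityTheory.cond volume (Set.Icc (0 : ℝ) 2),
    ProbabilityTheory.cond_isProbabilityMeasure_of_finite (by simp) (by simp)⟩

/-- The mixed strategy `s_{α,μ}`: the biased geometric strategy whose offset is uniform on
`[0, 2]`. -/
noncomputable def geometricStrategy (α μ : ℝ) (hα : 1 < α) (hμ : 0 < μ) : MixedStrategy :=
  uniformOffset.map (measurable_geometricPure α μ hα hμ).aemeasurable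

/-- `f_l(α) = 1 + l + (1 + l + 2 √l α) / ln α`. -/
noncomputable def objective (l α : ℝ) : ℝ :=
  1 + l + (1 + l + 2 * Real.sqrt l * α) / Real.log α

/-- `α` minimizes `f_l` over `(1, ∞)`. -/
def IsOptimalBase (l α : ℝ) : Prop :=
  1 < α ∧ ∀ β : ℝ, 1 < β → objective l α ≤ objective l β

end LinearSearch

/-!
Pareto optimality of the geometric strategies and the shape of the frontier both
follow from one sharp bound: every mixed strategy of finite robustness satisfies
`C + λ R ≥ 1 + λ + 2 √λ α`, where `α` is the optimal base (`consistency_add_robustness_ge`), and the strategy with base `α` and bias `√λ`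
attains it (`curve_identity`). By the tangent inequality for `log`, the base is characterized by
`2 √λ (α log α - α) = 1 + λ`, and the right-hand side is the minimum of `objective λ`.

*Lower bound.* Let the Hider be on the right with density `dy / y` and on the left with `λ` times the
mirrored density, at distances in `(1, N]`. By Tonelli it is enough to bound the average payoff of
almost every pure strategy. The point at distance `y` costs `y` plus twice its `overhead`, the sum of
the `x i` over all iterations after which it is unexplored. Exchanging sum and integral, iteration
`i` contributes to the averaged overhead about `w i + w (i - 1) * x i / x (i - 1)`, where `w` is the
weight of the side explored. The tangent line of `log` at the optimal ratio (`side_tangent`) bounds this by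
`√λ α (log (x i) - log (x (i - 1)))` plus a defect of alternating sign, so the sum telescopes to
`√λ α log N` up to lower-order terms (`exists_sum_iterationTerm_ge`). Dividing by `log N` and letting
`N → ∞` gives the bound. Only strategies of finite robustness matter here, and for them
almost surely the radii tend to `∞` in the future and to `0` in the past, as the telescoping needs.

*The geometric strategies.* For an offset uniform on `[0, 2]` the sum over every second iteration
unfolds to an integral over `ℝ`, and the expected overhead becomes `∫ α ^ v dv` over a half-line.

*The frontier.* The consistency along the curve takes every value in `(1, C₁]`, where `C₁ = R₁` is
the value of the unbiased optimal strategy (`exists_isOptimalBase_of_consistency`), and the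
consistency of every mixed strategy exceeds `1` (`one_lt_consistency`). So a Pareto optimal strategy
can be compared with the geometric strategy of the same consistency, or with the unbiased one, and
must agree with it in both criteria.
-/

namespace LinearSearch

/-! ### The overhead of a pure strategy -/

/-- The point at distance `y` from the origin in direction `b` (`true` is right). -/
def hiderPoint (b : Bool) (y : ℝ) : ℝ := if b then y else -y

lemma abs_hiderPoint (b : Bool) {y : ℝ} (hy : 0 < y) : |hiderPoint b y| = y := by
  cases b <;> simp [hiderPoint, abs_of_pos hy]

lemma reaches_hiderPoint_iff (S : PureStrategy) (i : ℤ) (b : Bool) {y : ℝ} (hy : 0 < y) :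
    S.Reaches i (hiderPoint b y) ↔ S.dir i = b ∧ y ≤ S.x i := by
  cases b <;> simp [PureStrategy.Reaches, hiderPoint, abs_of_pos hy, hy, hy.le]

lemma PureStrategy.dir_sub_one (S : PureStrategy) (i : ℤ) : S.dir (i - 1) = !S.dir i := by
  have h := S.dir_alternates (i - 1)
  rw [sub_add_cancel] at h
  cases h1 : S.dir i <;> cases h2 : S.dir (i - 1) <;> simp_all

/-- The part of the half-line in direction `b` that is explored after iteration `i` is the segment
of this length: the last of the iterations `i`, `i - 1` that went in direction `b` decides. -/
def PureStrategy.explored (S : PureStrategy) (b : Bool) (i : ℤ) : ℝ :=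
  if S.dir i = b then S.x i else S.x (i - 1)

lemma PureStrategy.explored_dir (S : PureStrategy) (i : ℤ) : S.explored (S.dir i) i = S.x i := by
  simp [PureStrategy.explored]

lemma PureStrategy.explored_not_dir (S : PureStrategy) (i : ℤ) :
    S.explored (!S.dir i) i = S.x (i - 1) := by
  simp [PureStrategy.explored]

lemma PureStrategy.explored_mono (S : PureStrategy) (b : Bool) : Monotone (S.explored b) := by
  refine monotone_int_of_le_succ fun i => ?_
  have hd := S.dir_sub_one (i + 1)
  rw [add_sub_cancel_right] at hd
  have hx := S.x_strict (i - 1)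
  rw [show i - 1 + 2 = i + 1 by ring] at hx
  have e : i + 1 - 1 = i := by ring
  cases b <;> cases h : S.dir (i + 1) <;> simp_all [PureStrategy.explored, hx.le]

/-- The total length of the iterations that precede the discovery of the point at distance `y` in
direction `b`, written as a sum over all iterations after which the point is still unexplored. -/
noncomputable def overhead (S : PureStrategy) (b : Bool) (y : ℝ) : ℝ≥0∞ :=
  ∑' i : ℤ, if S.explored b i < y then ENNReal.ofReal (S.x i) else 0

lemma explored_lt_iff_of_isLeast {S : PureStrategy} {b : Bool} {y : ℝ} (hy : 0 < y) {j : ℤ}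
    (hj : IsLeast {i : ℤ | S.Reaches i (hiderPoint b y)} j) (i : ℤ) :
    S.explored b i < y ↔ i < j := by
  have hr : ∀ k, S.Reaches k (hiderPoint b y) ↔ S.dir k = b ∧ y ≤ S.x k :=
    fun k => reaches_hiderPoint_iff S k b hy
  have hj1 := (hr j).1 hj.1
  constructor
  · intro h
    by_contra! hji
    have h1 := S.explored_mono b hji
    rw [← hj1.1, S.explored_dir, hj1.1] at h1
    linarith [hj1.2]
  · intro h
    have hn : ∀ k, k < j → S.dir k = b → S.x k < y := by
      intro k hk hb
      by_contra! hy'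
      exact absurd (hj.2 ((hr k).2 ⟨hb, hy'⟩)) (not_le.2 hk)
    by_cases hb : S.dir i = b
    · rw [← hb, S.explored_dir]
      exact hn i h hb
    · have hb' : b = !S.dir i := by cases b <;> cases h : S.dir i <;> simp_all
      rw [hb', S.explored_not_dir]
      exact hn _ (by omega) (by rw [S.dir_sub_one, hb'])

lemma cost_of_isLeast {S : PureStrategy} {b : Bool} {y : ℝ} (hy : 0 < y) {j : ℤ}
    (hj : IsLeast {i : ℤ | S.Reaches i (hiderPoint b y)} j) :
    ENNReal.ofReal |hiderPoint b y| + 2 * ∑' i : Set.Iio j, ENNReal.ofReal (S.x i) =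
      ENNReal.ofReal y + 2 * overhead S b y := by
  rw [abs_hiderPoint b hy, overhead, tsum_subtype (Set.Iio j) fun i => ENNReal.ofReal (S.x i)]
  congr 3
  ext i
  simp [Set.indicator, explored_lt_iff_of_isLeast hy hj]

lemma le_cost (S : PureStrategy) (b : Bool) {y : ℝ} (hy : 0 < y) :
    ENNReal.ofReal y + 2 * overhead S b y ≤ cost S (hiderPoint b y) :=
  le_iInf₂ fun _ hj => (cost_of_isLeast hy hj).ge

lemma cost_eq_of_reaches {S : PureStrategy} {b : Bool} {y : ℝ} (hy : 0 < y)
    (hne : ∃ i, S.Reaches i (hiderPoint b y))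
    (hbdd : ∃ m, ∀ i, S.Reaches i (hiderPoint b y) → m ≤ i) :
    cost S (hiderPoint b y) = ENNReal.ofReal y + 2 * overhead S b y := by
  obtain ⟨j, hj, hj'⟩ := Int.exists_least_of_bdd hbdd hne
  have hl : IsLeast {i : ℤ | S.Reaches i (hiderPoint b y)} j := ⟨hj, fun i hi => hj' i hi⟩
  exact le_antisymm ((iInf₂_le j hl).trans (cost_of_isLeast hy hl).le) (le_cost S b hy)

lemma payoff_hiderPoint_ge (S : PureStrategy) (b : Bool) {y : ℝ} (hy : 0 < y) :
    1 + 2 * overhead S b y * ENNReal.ofReal (1 / y) ≤ payoff S (hiderPoint b y) := by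
  have hy0 : ENNReal.ofReal y ≠ 0 := by simpa using hy
  rw [payoff, abs_hiderPoint b hy, ENNReal.le_div_iff_mul_le (Or.inl hy0) (Or.inl (by simp)),
    add_mul, one_mul, mul_assoc, ← ENNReal.ofReal_mul (by positivity), one_div_mul_cancel hy.ne']
  simpa using le_cost S b hy

lemma payoff_eq_of_reaches {S : PureStrategy} {b : Bool} {y : ℝ} (hy : 0 < y)
    (hne : ∃ i, S.Reaches i (hiderPoint b y))
    (hbdd : ∃ m, ∀ i, S.Reaches i (hiderPoint b y) → m ≤ i) :
    payoff S (hiderPoint b y) = 1 + 2 * overhead S b y * ENNReal.ofReal (1 / y) := by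
  have hy0 : ENNReal.ofReal y ≠ 0 := by simpa using hy
  refine le_antisymm ?_ (payoff_hiderPoint_ge S b hy)
  rw [payoff, abs_hiderPoint b hy, cost_eq_of_reaches hy hne hbdd]
  refine ENNReal.div_le_of_le_mul ?_
  rw [add_mul, one_mul, mul_assoc, ← ENNReal.ofReal_mul (by positivity), one_div_mul_cancel hy.ne']
  simp

lemma measurable_x (i : ℤ) : Measurable fun S : PureStrategy => S.x i :=
  (measurable_pi_apply i).comp (measurable_fst.comp (comap_measurable _))

lemma measurable_dir (i : ℤ) : Measurable fun S : PureStrategy => S.dir i :=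
  (measurable_pi_apply i).comp (measurable_snd.comp (comap_measurable _))

lemma measurable_explored (b : Bool) (i : ℤ) :
    Measurable fun S : PureStrategy => S.explored b i :=
  Measurable.ite ((measurable_dir i) (measurableSet_singleton b)) (measurable_x i)
    (measurable_x (i - 1))

lemma measurable_overhead (b : Bool) :
    Measurable fun p : PureStrategy × ℝ => overhead p.1 b p.2 := by
  refine Measurable.tsum fun i => ?_
  refine Measurable.ite ?_ ((measurable_x i).comp measurable_fst).ennreal_ofReal measurable_const
  exact measurableSet_lt ((measurable_explored b i).comp measurable_fst) measurable_snd

lemma measurable_overhead_left (b : Bool) (y : ℝ) :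
    Measurable fun S : PureStrategy => overhead S b y :=
  (measurable_overhead b).comp (measurable_id.prodMk measurable_const)

lemma expectedPayoff_hiderPoint_ge (s : MixedStrategy) (b : Bool) {y : ℝ} (hy : 0 < y) :
    1 + 2 * (∫⁻ S, overhead S b y ∂(s : Measure PureStrategy)) * ENNReal.ofReal (1 / y) ≤
      expectedPayoff s (hiderPoint b y) := by
  refine le_trans (le_of_eq ?_) (lintegral_mono fun S => payoff_hiderPoint_ge S b hy)
  have hm := measurable_overhead_left b y
  rw [lintegral_add_left measurable_const, lintegral_mul_const _ (hm.const_mul 2),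
    lintegral_const_mul _ hm]
  simp

/-- If the overhead is finite at arbitrarily distant points of both half-lines, then the search
radii tend to infinity in the future and to zero in the past. -/
lemma radii_of_overhead_ne_top {S : PureStrategy}
    (h : ∀ (b : Bool) (n : ℕ), overhead S b (n + 1) ≠ ⊤) :
    (∀ B : ℝ, ∃ J : ℤ, ∀ i, J ≤ i → B < S.x i) ∧
      ∀ ε : ℝ, 0 < ε → ∃ J : ℤ, ∀ i, i ≤ J → S.x i < ε := by
  have hfin : ∀ b (n : ℕ) (ε : ℝ), 0 < ε →
      {i : ℤ | S.explored b i < n + 1 ∧ ε ≤ S.x i}.Finite := by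
    intro b n ε hε
    have h1 := ENNReal.tendsto_cofinite_zero_of_tsum_ne_top (h b n)
    have h2 := h1.eventually_lt_const (show (0 : ℝ≥0∞) < ENNReal.ofReal ε by simpa using hε)
    refine (Filter.eventually_cofinite.1 h2).subset ?_
    rintro i ⟨hi, hi'⟩
    simp only [Set.mem_ofPred_eq, hi, if_true, not_lt]
    exact ENNReal.ofReal_le_ofReal hi'
  constructor
  · intro B
    have key : ∀ b, ∃ i, B < S.explored b i := by
      intro b
      by_contra! hB
      obtain ⟨n, hn⟩ := exists_nat_gt B
      have hmono : Monotone fun k : ℕ => S.x (2 * k) := by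
        refine monotone_nat_of_le_succ fun k => ?_
        have := S.x_strict (2 * k)
        push_cast
        rw [show (2 : ℤ) * (k + 1) = 2 * k + 2 by ring]
        exact this.le
      have hinf : (Set.range fun k : ℕ => (2 * k : ℤ)).Infinite :=
        Set.infinite_range_of_injective fun a b hab => by simpa using hab
      refine hinf ((hfin b n (S.x 0) (S.x_pos 0)).subset ?_)
      rintro _ ⟨k, rfl⟩
      exact ⟨by linarith [hB (2 * k)], by simpa using hmono (Nat.zero_le k)⟩
    choose f hf using key
    refine ⟨max (f true) (f false), fun i hi => ?_⟩
    have hi' : f (S.dir i) ≤ i := by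
      cases S.dir i
      · exact (le_max_right _ _).trans hi
      · exact (le_max_left _ _).trans hi
    calc B < S.explored (S.dir i) (f (S.dir i)) := hf _
      _ ≤ S.explored (S.dir i) i := S.explored_mono _ hi'
      _ = S.x i := S.explored_dir i
  · intro ε hε
    obtain ⟨n, hn⟩ := exists_nat_gt (S.explored true 0)
    obtain ⟨m, hm⟩ := (hfin true n ε hε).bddBelow
    refine ⟨min 0 (m - 1), fun i hi => ?_⟩
    by_contra! hx
    have h1 := S.explored_mono true (hi.trans (min_le_left _ _))
    have h2 := hm (show i ∈ _ from ⟨by linarith, hx⟩)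
    have h3 := hi.trans (min_le_right _ _)
    omega

/-! ### Lower bound for pure strategies -/

lemma lintegral_inv_sq {a N : ℝ} (ha : 0 < a) (h : a ≤ N) :
    ∫⁻ y in Ioc a N, ENNReal.ofReal (1 / y ^ 2) = ENNReal.ofReal (1 / a - 1 / N) := by
  have h0 : (0 : ℝ) ∉ Set.uIcc a N := by
    rw [Set.uIcc_of_le h]; exact fun hh => absurd hh.1 (not_le.2 ha)
  have hc : ContinuousOn (fun y : ℝ => 1 / y ^ 2) (Set.uIcc a N) := by
    refine ContinuousOn.div continuousOn_const (by fun_prop) fun y hy hy' => h0 ?_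
    rwa [pow_eq_zero_iff (by norm_num) |>.1 hy'] at hy
  have hi := hc.intervalIntegrable (μ := volume)
  rw [← ofReal_integral_eq_lintegral_ofReal ((intervalIntegrable_iff_integrableOn_Ioc_of_le h).1 hi)
    (Filter.Eventually.of_forall fun y => by positivity),
    ← intervalIntegral.integral_of_le h]
  congr 1
  rw [intervalIntegral.integral_eq_sub_of_hasDerivAt (f := fun y => -(1 / y)) _ hi]
  · ring
  · intro y hy
    have hy0 : y ≠ 0 := fun e => h0 (e ▸ hy)
    have := (hasDerivAt_inv hy0).fun_neg
    simpa [one_div] using this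

lemma lintegral_inv {N : ℝ} (h : 1 ≤ N) :
    ∫⁻ y in Ioc 1 N, ENNReal.ofReal (1 / y) = ENNReal.ofReal (Real.log N) := by
  have h0 : (0 : ℝ) ∉ Set.uIcc 1 N := by
    rw [Set.uIcc_of_le h]; exact fun hh => absurd hh.1 (by norm_num)
  have hc : ContinuousOn (fun y : ℝ => 1 / y) (Set.uIcc 1 N) :=
    continuousOn_const.div continuousOn_id fun y hy hy' => h0 (by rwa [hy'] at hy)
  have hi := hc.intervalIntegrable (μ := volume)
  rw [← ofReal_integral_eq_lintegral_ofReal ((intervalIntegrable_iff_integrableOn_Ioc_of_le h).1 hi),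
    ← intervalIntegral.integral_of_le h, integral_one_div h0, div_one]
  filter_upwards [ae_restrict_mem measurableSet_Ioc] with y hy
  have : 0 < y := by linarith [hy.1]
  positivity

lemma le_lintegral_overhead (S : PureStrategy) (b : Bool) {N : ℝ} (hN : 0 < N) :
    ∑' i : ℤ, ENNReal.ofReal (S.x i) * ENNReal.ofReal (1 / max (S.explored b i) 1 - 1 / N) ≤
      ∫⁻ y in Ioc 1 N, overhead S b y * ENNReal.ofReal (1 / y ^ 2) := by
  have hm : Measurable fun y : ℝ => ENNReal.ofReal (1 / y ^ 2) := by fun_prop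
  have hterm : ∀ i : ℤ, Measurable fun y : ℝ =>
      (if S.explored b i < y then ENNReal.ofReal (S.x i) else 0) * ENNReal.ofReal (1 / y ^ 2) :=
    fun i => (Measurable.ite measurableSet_Ioi measurable_const measurable_const).mul hm
  simp_rw [overhead, ← ENNReal.tsum_mul_right]
  rw [lintegral_tsum fun i => (hterm i).aemeasurable]
  refine ENNReal.tsum_le_tsum fun i => ?_
  set a := max (S.explored b i) 1 with ha
  have ha1 : 1 ≤ a := le_max_right _ _
  rcases le_or_gt a N with h | h
  · rw [← lintegral_inv_sq (by linarith) h, ← lintegral_const_mul _ hm]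
    calc ∫⁻ y in Ioc a N, ENNReal.ofReal (S.x i) * ENNReal.ofReal (1 / y ^ 2)
        = ∫⁻ y in Ioc a N, (if S.explored b i < y then ENNReal.ofReal (S.x i) else 0) *
            ENNReal.ofReal (1 / y ^ 2) := by
          refine setLIntegral_congr_fun measurableSet_Ioc fun y hy => ?_
          have : S.explored b i < y := (le_max_left _ _).trans_lt hy.1
          simp [this]
      _ ≤ _ := lintegral_mono_set (Ioc_subset_Ioc_left ha1)
  · have : 1 / a - 1 / N ≤ 0 := sub_nonpos.2 (one_div_le_one_div_of_le hN h.le)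
    rw [ENNReal.ofReal_of_nonpos this, mul_zero]
    exact zero_le

/-- The weight of the half-line in direction `b`: the left one counts `l` times the right one. -/
def sideWeight (l : ℝ) (b : Bool) : ℝ := if b then 1 else l

/-- The sign `1` of the right half-line and `-1` of the left one. -/
def sideSign (b : Bool) : ℝ := if b then 1 else -1

/-- Tangent-line bound for the cost of one iteration in direction `b` with ratio `ρ` to the
preceding one, at the ratio that is optimal for `α`. The two directions have opposite defects. -/
lemma side_tangent {m α : ℝ} (hm : 0 < m) (hα : 1 < α)
    (h : 2 * m * (α * Real.log α - α) = 1 + m ^ 2) (b : Bool) {ρ : ℝ} (hρ : 0 < ρ) :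
    m * α * Real.log ρ + sideSign b * ((1 - m ^ 2) / 2 + m * α * Real.log m) ≤
      sideWeight (m ^ 2) b + sideWeight (m ^ 2) (!b) * ρ := by
  have h0 : 0 < α := by linarith
  have key : ∀ t : ℝ, 0 < t → m * α * (1 + Real.log t - Real.log m - Real.log α) ≤ t := by
    intro t ht
    have h1 := Real.log_le_sub_one_of_pos (show 0 < t / (m * α) by positivity)
    rw [Real.log_div ht.ne' (by positivity), Real.log_mul hm.ne' h0.ne'] at h1
    have h2 := mul_le_mul_of_nonneg_left h1 (show 0 ≤ m * α by positivity)
    have h3 : m * α * (t / (m * α) - 1) = t - m * α := by field_simp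
    nlinarith
  cases b
  · have := key ρ hρ
    simp only [sideSign, sideWeight, Bool.not_false, if_true]
    norm_num
    nlinarith
  · have := key (m ^ 2 * ρ) (by positivity)
    rw [Real.log_mul (by positivity) hρ.ne', Real.log_pow] at this
    simp only [sideSign, sideWeight, Bool.not_true, if_true]
    norm_num
    push_cast at this
    nlinarith

/-- The weighted contribution of iteration `i` to the overhead of a Hider with density `dy / y` on
`(1, N]` and its mirror image. -/
noncomputable def iterationTerm (S : PureStrategy) (l N : ℝ) (i : ℤ) : ℝ :=
  S.x i * (sideWeight l (S.dir i) * max (1 / max (S.x i) 1 - 1 / N) 0 +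
    sideWeight l (!S.dir i) * max (1 / max (S.x (i - 1)) 1 - 1 / N) 0)

lemma iterationTerm_ge {S : PureStrategy} {m α M T : ℝ} (hm : 0 < m) (hα : 1 < α)
    (h : 2 * m * (α * Real.log α - α) = 1 + m ^ 2) (hM : 1 < M) (hT : 1 ≤ T) {i : ℤ}
    (h1 : 1 ≤ S.x i) (h2 : S.x i ≤ T) (h3 : S.x (i - 1) ≤ T) :
    (1 - 1 / M) * (m * α * (Real.log (max (S.x i) 1) - Real.log (max (S.x (i - 1)) 1)) +
      sideSign (S.dir i) * ((1 - m ^ 2) / 2 + m * α * Real.log m)) ≤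
      iterationTerm S (m ^ 2) (M * T) i := by
  have hz : ∀ a : ℝ, 1 ≤ a → a ≤ T → (1 - 1 / M) * (1 / a) ≤ 1 / a - 1 / (M * T) := by
    intro a ha haT
    have : 1 / (M * T) ≤ 1 / M * (1 / a) := by
      rw [one_div_mul_one_div]
      exact one_div_le_one_div_of_le (by positivity) (by gcongr)
    linarith
  set z := max (S.x (i - 1)) 1
  have hz1 : 1 ≤ z := le_max_right _ _
  have hx : max (S.x i) 1 = S.x i := max_eq_left h1
  have hw : ∀ b, 0 ≤ sideWeight (m ^ 2) b := by intro b; cases b <;> simp [sideWeight]; positivity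
  have hM' : 0 ≤ 1 - 1 / M := by
    rw [sub_nonneg, div_le_one (by linarith)]; exact hM.le
  have ht := side_tangent hm hα h (S.dir i) (show 0 < S.x i / z by positivity)
  rw [Real.log_div (by positivity) (by positivity)] at ht
  rw [iterationTerm, hx]
  refine (mul_le_mul_of_nonneg_left ht hM').trans ?_
  have e : (1 - 1 / M) * (sideWeight (m ^ 2) (S.dir i) +
      sideWeight (m ^ 2) (!S.dir i) * (S.x i / z)) = S.x i * (sideWeight (m ^ 2) (S.dir i) *
        ((1 - 1 / M) * (1 / S.x i)) + sideWeight (m ^ 2) (!S.dir i) * ((1 - 1 / M) * (1 / z))) := by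
    have : S.x i ≠ 0 := by positivity
    field_simp
  rw [e]
  have ha := (hz _ h1 h2).trans (le_max_left _ 0)
  have hb := (hz z hz1 (max_le h3 hT)).trans (le_max_left _ 0)
  have := hw (S.dir i)
  have := hw (!S.dir i)
  gcongr

/-- The contribution of the first iteration that exceeds the radius `T`. -/
lemma iterationTerm_ge_of_lt {S : PureStrategy} {m α M T : ℝ} (hm : 0 < m) (hm1 : m ≤ 1)
    (hα : 1 < α) (h : 2 * m * (α * Real.log α - α) = 1 + m ^ 2) (hM : 1 < M) (hT : 1 ≤ T) {i : ℤ}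
    (h2 : T < S.x i) (h3 : S.x (i - 1) ≤ T) :
    (1 - 1 / M) * (m * α * (Real.log T - Real.log (max (S.x (i - 1)) 1)) +
      sideSign (S.dir i) * ((1 - m ^ 2) / 2 + m * α * Real.log m) - 1) ≤
      iterationTerm S (m ^ 2) (M * T) i := by
  set z := max (S.x (i - 1)) 1
  have hz1 : 1 ≤ z := le_max_right _ _
  have hzT : z ≤ T := max_le h3 hT
  have hb : (1 - 1 / M) * (1 / z) ≤ 1 / z - 1 / (M * T) := by
    have : 1 / (M * T) ≤ 1 / M * (1 / z) := by
      rw [one_div_mul_one_div]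
      exact one_div_le_one_div_of_le (by positivity) (by gcongr)
    linarith
  have hw : ∀ b, 0 ≤ sideWeight (m ^ 2) b := by intro b; cases b <;> simp [sideWeight]; positivity
  have hw1 : ∀ b, sideWeight (m ^ 2) b ≤ 1 := by
    intro b; cases b <;> simp [sideWeight]; rw [abs_le]; constructor <;> linarith
  have hM' : 0 ≤ 1 - 1 / M := by
    rw [sub_nonneg, div_le_one (by linarith)]; exact hM.le
  have ht := side_tangent hm hα h (S.dir i) (show 0 < T / z by positivity)
  rw [Real.log_div (by positivity) (by positivity)] at ht
  have := hw (S.dir i)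
  have := hw (!S.dir i)
  calc _ ≤ (1 - 1 / M) * (sideWeight (m ^ 2) (!S.dir i) * (T / z)) := by
        refine mul_le_mul_of_nonneg_left ?_ hM'
        linarith [hw1 (S.dir i)]
    _ = T * (sideWeight (m ^ 2) (!S.dir i) * ((1 - 1 / M) * (1 / z))) := by field_simp
    _ ≤ S.x i * (sideWeight (m ^ 2) (!S.dir i) * max (1 / z - 1 / (M * T)) 0) := by
        have := hb.trans (le_max_left _ 0)
        have := S.x_pos i
        gcongr
    _ ≤ _ := by
        have hx := S.x_pos i
        have : 0 ≤ sideWeight (m ^ 2) (S.dir i) * max (1 / max (S.x i) 1 - 1 / (M * T)) 0 := by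
          positivity
        rw [iterationTerm]
        gcongr
        linarith

/-- The increments of the potential `m α log (max (x i) 1)`, corrected by half the alternating
defect, bound the iterations from below; the sum telescopes. -/
lemma sum_iterationTerm_ge {S : PureStrategy} {m α M T : ℝ} (hm : 0 < m)
    (hα : 1 < α) (h : 2 * m * (α * Real.log α - α) = 1 + m ^ 2) (hM : 1 < M) (hT : 1 ≤ T) {p : ℤ}
    (hp : S.x (p - 1) < 1) (hp' : ∀ i, p ≤ i → 1 ≤ S.x i) (n : ℕ)
    (hn : ∀ k < n, S.x (p + k) ≤ T) :
    (1 - 1 / M) * (m * α * Real.log (max (S.x (p + n - 1)) 1) +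
      (sideSign (S.dir (p + n - 1)) - sideSign (S.dir (p - 1))) / 2 *
        ((1 - m ^ 2) / 2 + m * α * Real.log m)) ≤
      ∑ k ∈ Finset.range n, iterationTerm S (m ^ 2) (M * T) (p + k) := by
  induction n with
  | zero => simp [max_eq_right hp.le]
  | succ n ih =>
    have h3 : S.x (p + n - 1) ≤ T := by
      cases n with
      | zero => simpa using hp.le.trans hT
      | succ n =>
        have := hn n (by omega)
        push_cast
        rwa [show p + ((n : ℤ) + 1) - 1 = p + n by ring]
    have ht := iterationTerm_ge (S := S) hm hα h hM hT (hp' (p + n) (by omega))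
      (hn n (by omega)) h3
    have ih' := ih fun k hk => hn k (by omega)
    have hs : sideSign (S.dir (p + n - 1)) = -sideSign (S.dir (p + n)) := by
      rw [S.dir_sub_one]; cases S.dir (p + n) <;> simp [sideSign]
    rw [Finset.sum_range_succ]
    push_cast
    rw [show p + ((n : ℤ) + 1) - 1 = p + n by ring]
    rw [hs] at ih'
    refine le_trans (le_of_eq ?_) (add_le_add ih' ht)
    ring

/-- Every pure strategy whose radii range from `0` to `∞` pays at least `m α log T`, up to a
constant. -/
lemma exists_sum_iterationTerm_ge {S : PureStrategy} {m α M T : ℝ} (hm : 0 < m) (hm1 : m ≤ 1)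
    (hα : 1 < α) (h : 2 * m * (α * Real.log α - α) = 1 + m ^ 2) (hM : 1 < M) (hT : 1 ≤ T)
    (hS : ∀ B : ℝ, ∃ J : ℤ, ∀ i, J ≤ i → B < S.x i)
    (hS' : ∀ ε : ℝ, 0 < ε → ∃ J : ℤ, ∀ i, i ≤ J → S.x i < ε) :
    ∃ s : Finset ℤ, (1 - 1 / M) *
      (m * α * Real.log T - (|(1 - m ^ 2) / 2 + m * α * Real.log m| + 1)) ≤
        ∑ i ∈ s, iterationTerm S (m ^ 2) (M * T) i := by
  -- The window starts at the first `p` from which on all radii are at least `1` and ends at the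
  -- first `p + n` whose radius exceeds `T`.
  obtain ⟨J, hJ⟩ := hS 1
  obtain ⟨J', hJ'⟩ := hS' 1 one_pos
  obtain ⟨q, hq, hq'⟩ := Int.exists_greatest_of_bdd (P := fun i => S.x i < 1)
    ⟨J, fun i hi => by by_contra! hh; linarith [hJ i hh.le]⟩ ⟨J', hJ' J' le_rfl⟩
  obtain ⟨p, rfl⟩ : ∃ p, q = p - 1 := ⟨q + 1, by ring⟩
  have hp' : ∀ i, p ≤ i → 1 ≤ S.x i := by
    intro i hi
    by_contra! hh
    have := hq' i hh
    omega
  have hex : ∃ n : ℕ, T < S.x (p + n) := by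
    obtain ⟨K, hK⟩ := hS T
    exact ⟨(K - p).toNat, hK _ (by omega)⟩
  classical
  let n := Nat.find hex
  have hn1 : T < S.x (p + n) := Nat.find_spec hex
  have hn2 : ∀ k < n, S.x (p + k) ≤ T := fun k hk => not_lt.1 (Nat.find_min hex hk)
  have h3 : S.x (p + n - 1) ≤ T := by
    rcases Nat.eq_zero_or_pos n with h0 | h0
    · rw [h0]; simpa using hq.le.trans hT
    · have := hn2 (n - 1) (by omega)
      rwa [show p + ((n - 1 : ℕ) : ℤ) = p + n - 1 by omega] at this
  refine ⟨(Finset.range (n + 1)).image fun k : ℕ => p + (k : ℤ), ?_⟩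
  rw [Finset.sum_image fun a _ b _ hab => by simpa using hab, Finset.sum_range_succ]
  refine le_trans ?_ (add_le_add (sum_iterationTerm_ge hm hα h hM hT hq hp' n hn2)
    (iterationTerm_ge_of_lt hm hm1 hα h hM hT hn1 h3))
  have hs : sideSign (S.dir (p + n - 1)) = -sideSign (S.dir (p + n)) := by
    rw [S.dir_sub_one]; cases S.dir (p + n) <;> simp [sideSign]
  rw [← mul_add, hs]
  have hM' : 0 ≤ 1 - 1 / M := by
    rw [sub_nonneg, div_le_one (by linarith)]; exact hM.le
  refine mul_le_mul_of_nonneg_left ?_ hM'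
  set κ := (1 - m ^ 2) / 2 + m * α * Real.log m
  have := neg_abs_le κ
  have := le_abs_self κ
  cases S.dir (p + n) <;> cases S.dir (p - 1) <;> norm_num [sideSign] <;> linarith [abs_nonneg κ]

/-! ### Lower bound for mixed strategies -/

/-- The overhead of `S` in direction `b`, averaged over a Hider with density `dy / y` on `(1, N]`
and normalized by the distance `y`. -/
noncomputable def averagedOverhead (N : ℝ) (b : Bool) (S : PureStrategy) : ℝ≥0∞ :=
  ∫⁻ y in Ioc 1 N, overhead S b y * ENNReal.ofReal (1 / y ^ 2)

lemma ofReal_iterationTerm {S : PureStrategy} {l N : ℝ} (hl : 0 ≤ l) (i : ℤ) :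
    ENNReal.ofReal (iterationTerm S l N i) =
      ENNReal.ofReal (S.x i) * ENNReal.ofReal (1 / max (S.explored true i) 1 - 1 / N) +
      ENNReal.ofReal l *
        (ENNReal.ofReal (S.x i) * ENNReal.ofReal (1 / max (S.explored false i) 1 - 1 / N)) := by
  have hx := (S.x_pos i).le
  have hmax : ∀ a : ℝ, ENNReal.ofReal a = ENNReal.ofReal (max a 0) := by
    intro a
    rcases le_total a 0 with h | h <;> simp [h]
  have e : iterationTerm S l N i = S.x i * max (1 / max (S.explored true i) 1 - 1 / N) 0 +
      l * (S.x i * max (1 / max (S.explored false i) 1 - 1 / N) 0) := by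
    have h1 := S.explored_dir i
    have h2 := S.explored_not_dir i
    rw [iterationTerm]
    cases h : S.dir i
    · rw [h] at h1 h2
      simp only [Bool.not_false] at h2
      simp only [h1, h2, sideWeight, Bool.not_false, if_true, Bool.false_eq_true, if_false]
      ring
    · rw [h] at h1 h2
      simp only [Bool.not_true] at h2
      simp only [h1, h2, sideWeight, Bool.not_true, if_true, Bool.false_eq_true, if_false]
      ring
  rw [e, ENNReal.ofReal_add (by positivity) (by positivity), ENNReal.ofReal_mul hl,
    ENNReal.ofReal_mul hx, ENNReal.ofReal_mul hx, ← hmax, ← hmax]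

lemma averagedOverhead_ge {S : PureStrategy} {m α M T : ℝ} (hm : 0 < m) (hm1 : m ≤ 1)
    (hα : 1 < α) (h : 2 * m * (α * Real.log α - α) = 1 + m ^ 2) (hM : 1 < M) (hT : 1 ≤ T)
    (hS : ∀ (b : Bool) (n : ℕ), overhead S b (n + 1) ≠ ⊤) :
    ENNReal.ofReal ((1 - 1 / M) *
      (m * α * Real.log T - (|(1 - m ^ 2) / 2 + m * α * Real.log m| + 1))) ≤
        averagedOverhead (M * T) true S + ENNReal.ofReal (m ^ 2) *
          averagedOverhead (M * T) false S := by
  obtain ⟨h1, h2⟩ := radii_of_overhead_ne_top hS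
  obtain ⟨s, hs⟩ := exists_sum_iterationTerm_ge hm hm1 hα h hM hT h1 h2
  have hN : 0 < M * T := by positivity
  refine (ENNReal.ofReal_le_ofReal hs).trans ((Finset.le_sum_of_subadditive
    ENNReal.ofReal ENNReal.ofReal_zero.le (fun _ _ => ENNReal.ofReal_add_le) s _).trans ?_)
  simp_rw [ofReal_iterationTerm (sq_nonneg m), Finset.sum_add_distrib, ← Finset.mul_sum]
  gcongr
  · exact (ENNReal.sum_le_tsum s).trans (le_lintegral_overhead S true hN)
  · exact (ENNReal.sum_le_tsum s).trans (le_lintegral_overhead S false hN)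

lemma measurable_averagedOverhead (N : ℝ) (b : Bool) : Measurable (averagedOverhead N b) := by
  have : Measurable fun p : PureStrategy × ℝ => overhead p.1 b p.2 * ENNReal.ofReal (1 / p.2 ^ 2) :=
    (measurable_overhead b).mul (by fun_prop)
  exact this.lintegral_prod_right'

/-- Averaging the expected payoff over the Hider's density `dy / y` on `(1, N]`. -/
lemma averaged_payoff_le (s : MixedStrategy) (b : Bool) {N : ℝ} (hN : 1 ≤ N) {V : ℝ≥0∞}
    (hV : ∀ y : ℝ, 0 < y → expectedPayoff s (hiderPoint b y) ≤ V) :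
    ENNReal.ofReal (Real.log N) +
      2 * ∫⁻ S, averagedOverhead N b S ∂(s : Measure PureStrategy) ≤
        V * ENNReal.ofReal (Real.log N) := by
  have hm : Measurable fun p : PureStrategy × ℝ =>
      overhead p.1 b p.2 * ENNReal.ofReal (1 / p.2 ^ 2) :=
    (measurable_overhead b).mul (by fun_prop)
  have hm1 : Measurable fun y : ℝ => ENNReal.ofReal (1 / y) := by fun_prop
  simp only [averagedOverhead]
  rw [lintegral_lintegral_swap hm.aemeasurable, ← lintegral_inv hN,
    ← lintegral_const_mul _ hm1,
    ← lintegral_const_mul _ hm.lintegral_prod_left', ← lintegral_add_left hm1]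
  refine setLIntegral_mono' measurableSet_Ioc fun y hy => ?_
  have hy0 : 0 < y := by linarith [hy.1]
  dsimp only
  rw [lintegral_mul_const _ (measurable_overhead_left b y)]
  refine le_trans (le_of_eq ?_)
    (mul_le_mul_left ((expectedPayoff_hiderPoint_ge s b hy0).trans (hV y hy0)) _)
  rw [add_mul, one_mul, mul_assoc (2 * _), ← ENNReal.ofReal_mul (by positivity), mul_assoc]
  congr 4
  field_simp

lemma ae_overhead_ne_top (s : MixedStrategy) (b : Bool) {y : ℝ} (hy : 0 < y)
    (h : expectedPayoff s (hiderPoint b y) ≠ ⊤) :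
    ∀ᵐ S ∂(s : Measure PureStrategy), overhead S b y ≠ ⊤ := by
  have h1 := ne_top_of_le_ne_top h (expectedPayoff_hiderPoint_ge s b hy)
  have h2 : ∫⁻ S, overhead S b y ∂(s : Measure PureStrategy) ≠ ⊤ := by
    intro h3
    have hy' : ENNReal.ofReal (1 / y) ≠ 0 := by simpa using hy
    refine h1 ?_
    rw [h3, ENNReal.mul_top (by norm_num), ENNReal.top_mul hy', add_top]
  filter_upwards [ae_lt_top (measurable_overhead_left b y) h2] with S hS using hS.ne

lemma expectedPayoff_le_consistency (s : MixedStrategy) {y : ℝ} (hy : 0 < y) :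
    expectedPayoff s (hiderPoint true y) ≤ consistency s :=
  le_iSup₂ (f := fun y (_ : y ∈ {y : ℝ | 0 < y}) => expectedPayoff s y) y hy

lemma expectedPayoff_le_robustness (s : MixedStrategy) (b : Bool) {y : ℝ} (hy : 0 < y) :
    expectedPayoff s (hiderPoint b y) ≤ robustness s := by
  refine le_iSup₂ (f := fun y (_ : y ∈ {y : ℝ | y ≠ 0}) => expectedPayoff s y) (hiderPoint b y) ?_
  rw [Set.mem_ofPred_eq, ← abs_pos, abs_hiderPoint b hy]
  exact hy

lemma consistency_le_robustness (s : MixedStrategy) : consistency s ≤ robustness s :=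
  iSup₂_le fun _ hy => expectedPayoff_le_robustness s true hy

/-- The weighted lower bound on a finite window of the Hider's distribution. -/
lemma consistency_add_robustness_ge_window (s : MixedStrategy) (hs : robustness s ≠ ⊤)
    {m α M T : ℝ} (hm : 0 < m) (hm1 : m ≤ 1)
    (hα : 1 < α) (h : 2 * m * (α * Real.log α - α) = 1 + m ^ 2) (hM : 1 < M) (hT : 1 ≤ T) :
    (1 + m ^ 2) * Real.log (M * T) + 2 * ((1 - 1 / M) *
      (m * α * Real.log T - (|(1 - m ^ 2) / 2 + m * α * Real.log m| + 1))) ≤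
      ((consistency s).toReal + m ^ 2 * (robustness s).toReal) * Real.log (M * T) := by
  have hC : consistency s ≠ ⊤ := ne_top_of_le_ne_top hs (consistency_le_robustness s)
  have hN : 1 ≤ M * T := one_le_mul_of_one_le_of_one_le hM.le hT
  set κ := |(1 - m ^ 2) / 2 + m * α * Real.log m| + 1
  set L := Real.log (M * T)
  have hL : 0 ≤ L := Real.log_nonneg hN
  have hae : ∀ᵐ S ∂(s : Measure PureStrategy), ∀ (b : Bool) (n : ℕ),
      overhead S b (n + 1) ≠ ⊤ := by
    refine ae_all_iff.2 fun b => ae_all_iff.2 fun n => ae_overhead_ne_top s b (by positivity) ?_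
    exact ne_top_of_le_ne_top hs (expectedPayoff_le_robustness s b (by positivity))
  have hI : ENNReal.ofReal ((1 - 1 / M) * (m * α * Real.log T - κ)) ≤
      (∫⁻ S, averagedOverhead (M * T) true S ∂(s : Measure PureStrategy)) +
        ENNReal.ofReal (m ^ 2) *
          ∫⁻ S, averagedOverhead (M * T) false S ∂(s : Measure PureStrategy) := by
    rw [← lintegral_const_mul _ (measurable_averagedOverhead _ _),
      ← lintegral_add_left (measurable_averagedOverhead _ _)]
    calc _ = ∫⁻ _, ENNReal.ofReal ((1 - 1 / M) * (m * α * Real.log T - κ))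
          ∂(s : Measure PureStrategy) := by simp
      _ ≤ _ := lintegral_mono_ae (hae.mono fun S hS =>
        averagedOverhead_ge hm hm1 hα h hM hT hS)
  have h1 := averaged_payoff_le s true hN fun y hy => expectedPayoff_le_consistency s hy
  have h2 := averaged_payoff_le s false hN fun y hy => expectedPayoff_le_robustness s false hy
  set A := ∫⁻ S, averagedOverhead (M * T) true S ∂(s : Measure PureStrategy)
  set B := ∫⁻ S, averagedOverhead (M * T) false S ∂(s : Measure PureStrategy)
  have h3 : ENNReal.ofReal ((1 + m ^ 2) * L) +
      2 * ENNReal.ofReal ((1 - 1 / M) * (m * α * Real.log T - κ)) ≤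
      (consistency s + ENNReal.ofReal (m ^ 2) * robustness s) * ENNReal.ofReal L := by
    calc _ ≤ ENNReal.ofReal ((1 + m ^ 2) * L) + 2 * (A + ENNReal.ofReal (m ^ 2) * B) := by gcongr
      _ = (ENNReal.ofReal L + 2 * A) + ENNReal.ofReal (m ^ 2) * (ENNReal.ofReal L + 2 * B) := by
        rw [add_mul, one_mul, ENNReal.ofReal_add hL (by positivity),
          ENNReal.ofReal_mul (sq_nonneg m)]
        ring
      _ ≤ consistency s * ENNReal.ofReal L +
          ENNReal.ofReal (m ^ 2) * (robustness s * ENNReal.ofReal L) := by gcongr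
      _ = _ := by ring
  have h4 : ENNReal.ofReal ((1 + m ^ 2) * L + 2 * ((1 - 1 / M) * (m * α * Real.log T - κ))) ≤
      ENNReal.ofReal (((consistency s).toReal + m ^ 2 * (robustness s).toReal) * L) := by
    refine ENNReal.ofReal_add_le.trans ?_
    have e : ENNReal.ofReal (((consistency s).toReal + m ^ 2 * (robustness s).toReal) * L) =
        (consistency s + ENNReal.ofReal (m ^ 2) * robustness s) * ENNReal.ofReal L := by
      rw [ENNReal.ofReal_mul (by positivity), ENNReal.ofReal_add (by positivity) (by positivity),
        ENNReal.ofReal_mul (sq_nonneg m), ENNReal.ofReal_toReal hC, ENNReal.ofReal_toReal hs]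
    rw [e, ENNReal.ofReal_mul (p := 2) (by norm_num), ENNReal.ofReal_ofNat]
    exact h3
  exact (ENNReal.ofReal_le_ofReal_iff (by positivity)).1 h4

/-- Every mixed strategy of finite robustness satisfies `C + λ R ≥ 1 + λ + 2 √λ α`, where `α` is the
optimal base: the limit of the window bound along `M = t`, `T = exp t`. -/
theorem consistency_add_robustness_ge (s : MixedStrategy) (hs : robustness s ≠ ⊤)
    {m α : ℝ} (hm : 0 < m) (hm1 : m ≤ 1)
    (hα : 1 < α) (h : 2 * m * (α * Real.log α - α) = 1 + m ^ 2) :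
    1 + m ^ 2 + 2 * m * α ≤ (consistency s).toReal + m ^ 2 * (robustness s).toReal := by
  set κ := |(1 - m ^ 2) / 2 + m * α * Real.log m| + 1 with hκ
  have hinv : Filter.Tendsto (fun t : ℝ => 1 / t) Filter.atTop (nhds 0) := by
    simpa using tendsto_inv_atTop_zero (𝕜 := ℝ)
  have hlog : Filter.Tendsto (fun t : ℝ => Real.log t / t) Filter.atTop (nhds 0) :=
    Real.isLittleO_log_id_atTop.tendsto_div_nhds_zero
  have hlim : Filter.Tendsto (fun t : ℝ => (1 + m ^ 2) * (1 + Real.log t / t) +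
      2 * ((1 - 1 / t) * (m * α - κ * (1 / t)))) Filter.atTop
      (nhds ((1 + m ^ 2) * (1 + 0) + 2 * ((1 - 0) * (m * α - κ * 0)))) :=
    ((hlog.const_add 1).const_mul _).add
      (((hinv.const_sub 1).mul ((hinv.const_mul κ).const_sub _)).const_mul 2)
  have hlim' : Filter.Tendsto (fun t : ℝ =>
      ((consistency s).toReal + m ^ 2 * (robustness s).toReal) * (1 + Real.log t / t))
      Filter.atTop
      (nhds (((consistency s).toReal + m ^ 2 * (robustness s).toReal) * (1 + 0))) :=
    (hlog.const_add 1).const_mul _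
  have := le_of_tendsto_of_tendsto hlim hlim' ?_
  · linarith
  filter_upwards [Filter.eventually_gt_atTop 1] with t ht
  have h0 : 0 < t := by linarith
  have hw := consistency_add_robustness_ge_window s hs hm hm1 hα h ht
    (Real.one_le_exp h0.le)
  rw [Real.log_mul h0.ne' (Real.exp_ne_zero t), Real.log_exp, ← hκ] at hw
  have hw' := div_le_div_of_nonneg_right hw h0.le
  refine le_trans (le_of_eq ?_) (hw'.trans (le_of_eq ?_))
  · field_simp
    ring
  · field_simp
    ring

/-! ### Consistency and robustness of the geometric strategies -/

section Geometric
/-- Unfolding of an integral over `ℝ` into translates of the interval `[0, 2]`. -/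
lemma tsum_setLIntegral_translate (f : ℝ → ℝ≥0∞) :
    ∑' k : ℤ, ∫⁻ u in Icc (0 : ℝ) 2, f (2 * k + u) = ∫⁻ v, f v := by
  rw [← setLIntegral_univ f, ← iUnion_Ioc_add_zsmul (p := (2 : ℝ)) (by norm_num) 0,
    lintegral_iUnion (fun _ => measurableSet_Ioc) (pairwise_disjoint_Ioc_add_zsmul 0 2)]
  refine tsum_congr fun k => ?_
  rw [setLIntegral_congr Ioc_ae_eq_Icc.symm]
  have h := (measurePreserving_add_left volume (2 * k : ℝ)).setLIntegral_comp_preimage_emb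
    (measurableEmbedding_addLeft _) f (Ioc (2 * k) (2 * k + 2))
  have e1 : (fun u : ℝ => 2 * (k : ℝ) + u) ⁻¹' Ioc (2 * k) (2 * k + 2) = Ioc 0 2 := by
    ext u; simp
  have e2 : Ioc ((0 : ℝ) + k • 2) (0 + (k + 1) • 2) = Ioc (2 * (k : ℝ)) (2 * k + 2) := by
    congr 1
    · simp; ring
    · simp; ring
  rw [e2, ← h, e1]

lemma lintegral_rpow_of_lt {α c : ℝ} (hα : 1 < α) (hc : 0 < c) :
    ∫⁻ v : ℝ, (if α ^ v < c then ENNReal.ofReal (α ^ v) else 0) =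
      ENNReal.ofReal (c / Real.log α) := by
  have h0 : 0 < α := by linarith
  have hl : 0 < Real.log α := Real.log_pos hα
  have e : (fun v : ℝ => if α ^ v < c then ENNReal.ofReal (α ^ v) else 0) =
      (Iio (Real.logb α c)).indicator fun v => ENNReal.ofReal (Real.exp (Real.log α * v)) := by
    ext v
    simp only [Set.indicator, Set.mem_Iio, Real.lt_logb_iff_rpow_lt hα hc,
      Real.rpow_def_of_pos h0]
  rw [e, lintegral_indicator measurableSet_Iio, setLIntegral_congr Iio_ae_eq_Iic,
    ← ofReal_integral_eq_lintegral_ofReal (integrableOn_exp_mul_Iic hl _)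
      (Filter.Eventually.of_forall fun _ => (Real.exp_pos _).le),
    integral_exp_mul_Iic hl, ← Real.rpow_def_of_pos h0, Real.rpow_logb h0 hα.ne' hc]

/-- The expected total length, for a uniform offset on `[0, 2]`, of every second iteration of the
geometric strategy (shifted by `r`) that stays below `c`. -/
lemma tsum_setLIntegral_rpow {α c : ℝ} (hα : 1 < α) (hc : 0 < c) (r : ℝ) :
    ∑' k : ℤ, ∫⁻ u in Icc (0 : ℝ) 2,
      (if α ^ (2 * k + u + r) < c then ENNReal.ofReal (α ^ (2 * k + u + r)) else 0) =
      ENNReal.ofReal (c / Real.log α) := by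
  rw [tsum_setLIntegral_translate
    fun v : ℝ => if α ^ (v + r) < c then ENNReal.ofReal (α ^ (v + r)) else 0,
    lintegral_add_right_eq_self (fun v : ℝ => if α ^ v < c then ENNReal.ofReal (α ^ v) else 0),
    lintegral_rpow_of_lt hα hc]

lemma lintegral_uniformOffset (f : ℝ → ℝ≥0∞) :
    ∫⁻ u, f u ∂(uniformOffset : Measure ℝ) = 2⁻¹ * ∫⁻ u in Icc (0 : ℝ) 2, f u := by
  change ∫⁻ u, f u ∂(ProbabilityTheory.cond volume (Set.Icc (0 : ℝ) 2)) = _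
  rw [ProbabilityTheory.cond, lintegral_smul_measure]
  simp

variable {α μ : ℝ}

lemma geometricPure_x_even (hα : 1 < α) (hμ : 0 < μ) (u : ℝ) (k : ℤ) :
    (geometricPure α μ hα hμ u).x (2 * k) = α ^ (2 * k + u) := by
  simp [geometricPure]

lemma geometricPure_x_odd (hα : 1 < α) (hμ : 0 < μ) (u : ℝ) (k : ℤ) :
    (geometricPure α μ hα hμ u).x (2 * k + 1) = μ * α ^ (2 * k + u + 1) := by
  have : ¬ Even (2 * k + 1) := by simp
  simp only [geometricPure, this, if_false]
  push_cast
  congr 2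
  ring

lemma geometricPure_dir_even (hα : 1 < α) (hμ : 0 < μ) (u : ℝ) (k : ℤ) :
    (geometricPure α μ hα hμ u).dir (2 * k) = true := by
  simp [geometricPure]

lemma geometricPure_dir_odd (hα : 1 < α) (hμ : 0 < μ) (u : ℝ) (k : ℤ) :
    (geometricPure α μ hα hμ u).dir (2 * k + 1) = false := by
  simp [geometricPure]

lemma geometricPure_explored_even (hα : 1 < α) (hμ : 0 < μ) (u : ℝ) (b : Bool) (k : ℤ) :
    (geometricPure α μ hα hμ u).explored b (2 * k) =
      if b then α ^ (2 * k + u) else μ * α ^ (2 * k + u + -1) := by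
  have h := geometricPure_x_odd hα hμ u (k - 1)
  rw [show 2 * (k - 1) + 1 = 2 * k - 1 by ring] at h
  rw [PureStrategy.explored, geometricPure_dir_even, geometricPure_x_even, h]
  push_cast
  rw [show 2 * ((k : ℝ) - 1) + u + 1 = 2 * k + u + -1 by ring]
  cases b <;> simp

lemma geometricPure_explored_odd (hα : 1 < α) (hμ : 0 < μ) (u : ℝ) (b : Bool) (k : ℤ) :
    (geometricPure α μ hα hμ u).explored b (2 * k + 1) =
      if b then α ^ (2 * k + u) else μ * α ^ (2 * k + u + 1) := by
  rw [PureStrategy.explored, geometricPure_dir_odd, geometricPure_x_odd, add_sub_cancel_right,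
    geometricPure_x_even]
  cases b <;> simp

lemma tsum_int_eq_even_add_odd (f : ℤ → ℝ≥0∞) :
    ∑' i, f i = ∑' k : ℤ, f (2 * k) + ∑' k : ℤ, f (2 * k + 1) := by
  have hi : Function.Injective fun k : ℤ => 2 * k := fun a b hab => by simpa using hab
  have hi' : Function.Injective fun k : ℤ => 2 * k + 1 := fun a b hab => by simpa using hab
  have hc : (Set.range fun k : ℤ => 2 * k)ᶜ = Set.range fun k : ℤ => 2 * k + 1 := by
    ext i
    simp only [Set.mem_compl_iff, Set.mem_range]
    constructor
    · intro h
      exact ⟨i / 2, by by_contra h'; exact h ⟨i / 2, by omega⟩⟩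
    · rintro ⟨k, rfl⟩ ⟨k', hk⟩
      omega
  rw [← ENNReal.summable.tsum_add_tsum_compl (s := Set.range fun k : ℤ => 2 * k)
    ENNReal.summable, hc, tsum_range f hi, tsum_range f hi']

lemma lintegral_overhead_geometricPure (hα : 1 < α) (hμ : 0 < μ) (b : Bool) {y : ℝ} (hy : 0 < y) :
    ∫⁻ u, overhead (geometricPure α μ hα hμ u) b y ∂(uniformOffset : Measure ℝ) =
      ENNReal.ofReal (y * ((1 + if b then μ * α else α / μ) / Real.log α) / 2) := by
  have h0 : 0 < α := by linarith
  have hl : 0 < Real.log α := Real.log_pos hα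
  have hmeas : ∀ i : ℤ, Measurable fun u : ℝ =>
      if (geometricPure α μ hα hμ u).explored b i < y then
        ENNReal.ofReal ((geometricPure α μ hα hμ u).x i) else 0 := by
    intro i
    have hg := measurable_geometricPure α μ hα hμ
    exact Measurable.ite (measurableSet_lt ((measurable_explored b i).comp hg) measurable_const)
      ((measurable_x i).comp hg).ennreal_ofReal measurable_const
  have hpow : ∀ r : ℝ, Measurable fun u : ℝ => α ^ (u + r) := fun r =>
    (Real.continuous_const_rpow h0.ne').measurable.comp (measurable_id.add measurable_const)
  -- Each half of the sum is a multiple of the integral of a truncated exponential.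
  have hhalf : ∀ (a c r : ℝ), 0 ≤ a → 0 < c → ∑' k : ℤ, ∫⁻ u in Icc (0 : ℝ) 2,
      (if α ^ (2 * k + u + r) < c then ENNReal.ofReal (a * α ^ (2 * k + u + r)) else 0) =
      ENNReal.ofReal (a * (c / Real.log α)) := by
    intro a c r ha hc
    rw [ENNReal.ofReal_mul ha, ← tsum_setLIntegral_rpow hα hc r, ← ENNReal.tsum_mul_left]
    refine tsum_congr fun k => ?_
    rw [← lintegral_const_mul']
    · simp [ENNReal.ofReal_mul ha]
    · simp
  rw [lintegral_uniformOffset]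
  simp only [overhead]
  rw [lintegral_tsum fun i => (hmeas i).aemeasurable, tsum_int_eq_even_add_odd]
  simp only [geometricPure_explored_even, geometricPure_explored_odd, geometricPure_x_even,
    geometricPure_x_odd]
  have h2 : (2⁻¹ : ℝ≥0∞) = ENNReal.ofReal 2⁻¹ := by
    rw [ENNReal.ofReal_inv_of_pos two_pos, ENNReal.ofReal_ofNat]
  cases b
  · have hE := hhalf α (y / μ) (-1) h0.le (by positivity)
    have hO := hhalf μ (y / μ) 1 hμ.le (by positivity)
    have e1 : ∀ v : ℝ, α * α ^ (v + -1) = α ^ v := by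
      intro v
      rw [Real.rpow_add h0, Real.rpow_neg_one]
      field_simp
    have e2 : ∀ t : ℝ, t < y / μ ↔ μ * t < y := fun t => by rw [lt_div_iff₀ hμ, mul_comm]
    simp only [e1, e2] at hE hO
    simp only [Bool.false_eq_true, if_false]
    rw [hE, hO, ← ENNReal.ofReal_add (by positivity) (by positivity), h2,
      ← ENNReal.ofReal_mul (by positivity)]
    congr 1
    field_simp
    ring
  · have hE := hhalf 1 y 0 zero_le_one hy
    have hO := hhalf (μ * α) y 0 (by positivity) hy
    simp only [add_zero, one_mul] at hE hO
    have e1 : ∀ v : ℝ, μ * α ^ (v + 1) = μ * α * α ^ v := by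
      intro v
      rw [Real.rpow_add h0, Real.rpow_one]
      ring
    simp only [if_true, e1]
    rw [hE, hO, ← ENNReal.ofReal_add (by positivity) (by positivity), h2,
      ← ENNReal.ofReal_mul (by positivity)]
    congr 1
    field_simp

lemma payoff_geometricPure (hα : 1 < α) (hμ : 0 < μ) (u : ℝ) (b : Bool) {y : ℝ} (hy : 0 < y) :
    payoff (geometricPure α μ hα hμ u) (hiderPoint b y) =
      1 + 2 * overhead (geometricPure α μ hα hμ u) b y * ENNReal.ofReal (1 / y) := by
  set S := geometricPure α μ hα hμ u
  obtain ⟨c, hc, hcy⟩ : ∃ c : ℝ, 0 < c ∧ ∀ i, S.dir i = b → (y ≤ S.x i ↔ c ≤ α ^ ((i : ℝ) + u)) := by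
    cases b
    · refine ⟨y / μ, by positivity, fun i hi => ?_⟩
      have : ¬ Even i := by simpa [S, geometricPure] using hi
      simp only [S, geometricPure, this, if_false]
      rw [div_le_iff₀ hμ, mul_comm]
    · refine ⟨y, hy, fun i hi => ?_⟩
      have : Even i := by simpa [S, geometricPure] using hi
      simp only [S, geometricPure, this, if_true]
  have hr : ∀ i, S.Reaches i (hiderPoint b y) ↔
      S.dir i = b ∧ Real.logb α c ≤ i + u := by
    intro i
    rw [reaches_hiderPoint_iff S i b hy]
    refine and_congr_right fun hi => ?_
    rw [hcy i hi, Real.logb_le_iff_le_rpow hα hc]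
  refine payoff_eq_of_reaches hy ?_ ⟨⌊Real.logb α c - u⌋, fun i hi => ?_⟩
  · obtain ⟨n, hn⟩ := exists_nat_ge (Real.logb α c - u)
    have hn0 : (0 : ℝ) ≤ n := Nat.cast_nonneg n
    cases b
    · refine ⟨2 * (n : ℤ) + 1, (hr _).2 ⟨geometricPure_dir_odd hα hμ u n, ?_⟩⟩
      push_cast
      linarith
    · refine ⟨2 * (n : ℤ), (hr _).2 ⟨geometricPure_dir_even hα hμ u n, ?_⟩⟩
      push_cast
      linarith
  · have h1 := ((hr i).1 hi).2
    have h2 := Int.floor_le (Real.logb α c - u)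
    have h3 : (⌊Real.logb α c - u⌋ : ℝ) ≤ i := by linarith
    exact_mod_cast h3

lemma expectedPayoff_geometricStrategy (hα : 1 < α) (hμ : 0 < μ) (b : Bool) {y : ℝ} (hy : 0 < y) :
    expectedPayoff (geometricStrategy α μ hα hμ) (hiderPoint b y) =
      ENNReal.ofReal (1 + (1 + if b then μ * α else α / μ) / Real.log α) := by
  have hg := measurable_geometricPure α μ hα hμ
  have hmap : (geometricStrategy α μ hα hμ : Measure PureStrategy) =
      (uniformOffset : Measure ℝ).map (geometricPure α μ hα hμ) := rfl
  have hl : 0 < Real.log α := Real.log_pos hα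
  have hm := measurable_overhead_left b y
  have hpos : 0 ≤ (1 + if b then μ * α else α / μ) / Real.log α := by
    cases b <;> simp <;> positivity
  have key : 1 + 2 * (∫⁻ u, overhead (geometricPure α μ hα hμ u) b y ∂(uniformOffset : Measure ℝ)) *
      ENNReal.ofReal (1 / y) =
      ENNReal.ofReal (1 + (1 + if b then μ * α else α / μ) / Real.log α) := by
    rw [lintegral_overhead_geometricPure hα hμ b hy, ENNReal.ofReal_add zero_le_one hpos,
      ENNReal.ofReal_one, ← ENNReal.ofReal_ofNat 2, ← ENNReal.ofReal_mul (by norm_num),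
      ← ENNReal.ofReal_mul (by positivity)]
    congr 2
    field_simp
  refine le_antisymm ?_ ?_
  · rw [expectedPayoff, hmap]
    refine (lintegral_map_le _ _).trans (le_of_eq ?_)
    simp_rw [payoff_geometricPure hα hμ _ b hy]
    have hmg : Measurable fun u => overhead (geometricPure α μ hα hμ u) b y := hm.comp hg
    rw [lintegral_add_left measurable_const, lintegral_mul_const _ (hmg.const_mul 2),
      lintegral_const_mul _ hmg]
    simpa using key
  · rw [← key, ← lintegral_map hm hg, ← hmap]
    exact expectedPayoff_hiderPoint_ge _ b hy

theorem consistency_geometricStrategy (hα : 1 < α) (hμ : 0 < μ) :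
    consistency (geometricStrategy α μ hα hμ) =
      ENNReal.ofReal (1 + (1 + μ * α) / Real.log α) := by
  refine le_antisymm (iSup₂_le fun y hy => ?_) ?_
  · exact (expectedPayoff_geometricStrategy hα hμ true hy).le
  · have h := expectedPayoff_geometricStrategy hα hμ true one_pos
    exact h.ge.trans (expectedPayoff_le_consistency _ one_pos)

theorem robustness_geometricStrategy (hα : 1 < α) (hμ : 0 < μ) (hμ1 : μ ≤ 1) :
    robustness (geometricStrategy α μ hα hμ) =
      ENNReal.ofReal (1 + (1 + α / μ) / Real.log α) := by
  have hl : 0 < Real.log α := Real.log_pos hα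
  refine le_antisymm (iSup₂_le fun y hy => ?_) ?_
  · obtain ⟨b, hb⟩ : ∃ b, y = hiderPoint b |y| := by
      rcases lt_or_gt_of_ne hy with h | h
      · exact ⟨false, by simp [hiderPoint, abs_of_neg h]⟩
      · exact ⟨true, by simp [hiderPoint, abs_of_pos h]⟩
    rw [hb, expectedPayoff_geometricStrategy hα hμ b (abs_pos.2 hy)]
    refine ENNReal.ofReal_le_ofReal ?_
    have : μ * α ≤ α / μ := by
      rw [le_div_iff₀ hμ]
      have : μ * μ ≤ 1 := mul_le_one₀ hμ1 hμ.le hμ1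
      nlinarith
    cases b
    · simp
    · simp only [if_true]
      gcongr
  · have h := expectedPayoff_geometricStrategy hα hμ false one_pos
    exact h.ge.trans (expectedPayoff_le_robustness _ false one_pos)

end Geometric

/-! ### The optimal base and the Pareto frontier -/

/-- The tangent-line inequality behind the optimality of the base. -/
lemma mul_log_lt {α β : ℝ} (hα : 0 < α) (hβ : 0 < β) (hne : β ≠ α) :
    α * Real.log β < α * Real.log α + (β - α) := by
  have h := Real.log_lt_sub_one_of_pos (show 0 < β / α by positivity)
    (by rwa [Ne, div_eq_one_iff_eq hα.ne'])
  rw [Real.log_div hβ.ne' hα.ne'] at h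
  have h2 := mul_lt_mul_of_pos_left h hα
  have h3 : α * (β / α - 1) = β - α := by field_simp
  linarith

lemma objective_eq_of_stationary {l α : ℝ} (hα : 1 < α)
    (h : 2 * √l * (α * Real.log α - α) = 1 + l) : objective l α = 1 + l + 2 * √l * α := by
  have hl : 0 < Real.log α := Real.log_pos hα
  rw [objective, ← h]
  field_simp
  ring

lemma objective_lt_of_stationary {l α β : ℝ} (hl : 0 < l) (hα : 1 < α)
    (h : 2 * √l * (α * Real.log α - α) = 1 + l) (hβ : 1 < β) (hne : β ≠ α) :
    objective l α < objective l β := by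
  have hlog : 0 < Real.log β := Real.log_pos hβ
  have hm : 0 < √l := Real.sqrt_pos.2 hl
  rw [objective_eq_of_stationary hα h, objective, add_lt_add_iff_left, lt_div_iff₀ hlog]
  have := mul_lt_mul_of_pos_left (mul_log_lt (by linarith) (by linarith) hne)
    (show 0 < 2 * √l by positivity)
  linarith

lemma exists_stationary {c : ℝ} (hc : 0 ≤ c) :
    ∃ α : ℝ, Real.exp 1 ≤ α ∧ 2 * (α * Real.log α - α) = c := by
  have hle : Real.exp 1 ≤ Real.exp (1 + c) := Real.exp_le_exp.2 (by linarith)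
  have hcont : ContinuousOn (fun α : ℝ => 2 * (α * Real.log α - α))
      (Icc (Real.exp 1) (Real.exp (1 + c))) := by
    have := Real.continuous_mul_log
    fun_prop
  have hmem : c ∈ Icc (2 * (Real.exp 1 * Real.log (Real.exp 1) - Real.exp 1))
      (2 * (Real.exp (1 + c) * Real.log (Real.exp (1 + c)) - Real.exp (1 + c))) := by
    rw [Real.log_exp, Real.log_exp]
    have := Real.one_le_exp (show 0 ≤ 1 + c by linarith)
    constructor <;> nlinarith
  obtain ⟨α, hα, h⟩ := intermediate_value_Icc hle hcont hmem
  exact ⟨α, hα.1, h⟩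

lemma isOptimalBase_of_stationary {l α : ℝ} (hl : 0 < l) (hα : 1 < α)
    (h : 2 * √l * (α * Real.log α - α) = 1 + l) : IsOptimalBase l α := by
  refine ⟨hα, fun β hβ => ?_⟩
  rcases eq_or_ne β α with rfl | hne
  · exact le_rfl
  · exact (objective_lt_of_stationary hl hα h hβ hne).le

lemma exists_stationary_base {l : ℝ} (hl : 0 < l) :
    ∃ α : ℝ, 1 < α ∧ 2 * √l * (α * Real.log α - α) = 1 + l := by
  have hm : 0 < √l := Real.sqrt_pos.2 hl
  obtain ⟨α, hα, h⟩ := exists_stationary (show 0 ≤ (1 + l) / √l by positivity)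
  refine ⟨α, by linarith [Real.add_one_lt_exp one_ne_zero], ?_⟩
  rw [mul_comm 2, mul_assoc, h]
  field_simp

lemma IsOptimalBase.eq_of_stationary {l α β : ℝ} (hα : IsOptimalBase l α) (hl : 0 < l)
    (hβ : 1 < β) (h : 2 * √l * (β * Real.log β - β) = 1 + l) : α = β := by
  by_contra hne
  exact absurd (hα.2 β hβ) (not_le.2 (objective_lt_of_stationary hl hβ h hα.1 hne))

lemma IsOptimalBase.stationary {l α : ℝ} (hα : IsOptimalBase l α) (hl : 0 < l) :
    2 * √l * (α * Real.log α - α) = 1 + l := by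
  obtain ⟨β, hβ, h⟩ := exists_stationary_base hl
  rwa [hα.eq_of_stationary hl hβ h]

lemma existsUnique_isOptimalBase {l : ℝ} (hl : 0 < l) : ∃! α : ℝ, IsOptimalBase l α := by
  obtain ⟨β, hβ, h⟩ := exists_stationary_base hl
  exact ⟨β, isOptimalBase_of_stationary hl hβ h, fun α hα => hα.eq_of_stationary hl hβ h⟩

/-- Every consistency strictly between `1` and that of the unbiased optimal strategy is attained on
the curve. The curve is parametrized by the base `α`: with `h = 2 (α log α - α)`, stationarity reads
`μ + 1 / μ = h`, whose root in `(0, 1]` is `(h - √(h ^ 2 - 4)) / 2`. -/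
lemma exists_isOptimalBase_of_consistency {a c : ℝ} (ha : 1 < a)
    (ha' : 2 * (a * Real.log a - a) = 2) (hc : 1 < c) (hca : c ≤ 1 + (1 + a) / Real.log a) :
    ∃ l α : ℝ, 0 < l ∧ l ≤ 1 ∧ IsOptimalBase l α ∧ 1 + (1 + √l * α) / Real.log α = c := by
  let h : ℝ → ℝ := fun α => 2 * (α * Real.log α - α)
  let μ : ℝ → ℝ := fun α => (h α - √(h α ^ 2 - 4)) / 2
  let g : ℝ → ℝ := fun α => 1 + (1 + μ α * α) / Real.log α
  have h2 : ∀ α, a ≤ α → 2 ≤ h α := by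
    intro α hα
    rcases eq_or_lt_of_le hα with rfl | hlt
    · exact ha'.ge
    · have h1 := mul_log_lt (α := α) (β := a) (by linarith) (by linarith) hlt.ne
      have hl := Real.log_pos ha
      have h3 : 0 ≤ (α - a) * Real.log a := mul_nonneg (by linarith) hl.le
      simp only [h]
      linarith
  have hroot : ∀ α, a ≤ α → μ α ^ 2 - h α * μ α + 1 = 0 := by
    intro α hα
    have hs := Real.sq_sqrt (show 0 ≤ h α ^ 2 - 4 by nlinarith [h2 α hα])
    simp only [μ]
    linear_combination hs / 4
  have hpos : ∀ α, a ≤ α → 0 < μ α := by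
    intro α hα
    have : √(h α ^ 2 - 4) < h α := by
      rw [Real.sqrt_lt' (by linarith [h2 α hα])]
      linarith
    simp only [μ]
    linarith
  have hle : ∀ α, a ≤ α → μ α ≤ 1 := by
    intro α hα
    have : h α - 2 ≤ √(h α ^ 2 - 4) := Real.le_sqrt_of_sq_le (by nlinarith [h2 α hα])
    simp only [μ]
    linarith
  have hga : g a = 1 + (1 + a) / Real.log a := by
    have : h a = 2 := ha'
    simp only [g, μ, this]
    norm_num
  -- For large `α` one has `μ α ≤ 1 / (log α - 1)`, so `g` comes close to `1`.
  obtain ⟨A, hA, hgA⟩ : ∃ A, a ≤ A ∧ g A ≤ c := by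
    set L := max 2 (2 / (c - 1))
    refine ⟨max a (Real.exp L), le_max_left _ _, ?_⟩
    set A := max a (Real.exp L) with hAdef
    have hA : a ≤ A := le_max_left _ _
    have hA0 : 0 < A := by linarith
    have hLA : L ≤ Real.log A := (Real.le_log_iff_exp_le hA0).2 (le_max_right _ _)
    have hl2 : 2 ≤ Real.log A := (le_max_left _ _).trans hLA
    have hlc : 2 / (c - 1) ≤ Real.log A := (le_max_right _ _).trans hLA
    have hμA : μ A * A ≤ 1 := by
      have h1 := hroot A hA
      have h3 := hpos A hA
      have h4 := hle A hA
      have h5 : μ A * h A ≤ 2 := by nlinarith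
      have h6 : A ≤ h A / 2 := by
        simp only [h]
        nlinarith
      nlinarith
    have hlpos : 0 < Real.log A := by linarith
    rw [div_le_iff₀ (by linarith)] at hlc
    have : (1 + μ A * A) / Real.log A ≤ c - 1 := by
      rw [div_le_iff₀ hlpos]
      linarith
    simp only [g]
    linarith
  have hcont : ContinuousOn g (Icc a A) := by
    have hlog : ContinuousOn Real.log (Icc a A) :=
      Real.continuousOn_log.mono fun x hx => by
        have : x ≠ 0 := by linarith [hx.1]
        simpa using this
    have hh : ContinuousOn h (Icc a A) :=
      continuousOn_const.mul ((continuousOn_id.mul hlog).sub continuousOn_id)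
    have hμ : ContinuousOn μ (Icc a A) :=
      (hh.sub ((hh.pow 2).sub continuousOn_const).sqrt).div_const 2
    refine continuousOn_const.add
      ((continuousOn_const.add (hμ.mul continuousOn_id)).div hlog fun x hx => ?_)
    exact (Real.log_pos (by linarith [hx.1])).ne'
  obtain ⟨α, hα, hgα⟩ := intermediate_value_Icc' hA hcont ⟨hgA, hca.trans hga.ge⟩
  have h3 := hpos α hα.1
  have hsq : √(μ α ^ 2) = μ α := Real.sqrt_sq h3.le
  refine ⟨μ α ^ 2, α, by positivity, pow_le_one₀ h3.le (hle α hα.1),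
    isOptimalBase_of_stationary (by positivity) (by linarith [hα.1]) ?_, by rw [hsq]; exact hgα⟩
  rw [hsq]
  have := hroot α hα.1
  simp only [h] at this
  linarith

/-- No mixed strategy finds every predicted position at the trivial cost: the iterations before a
far away point is reached have positive length. -/
lemma one_lt_consistency (s : MixedStrategy) : 1 < consistency s := by
  by_contra! hC
  have hae : ∀ᵐ S ∂(s : Measure PureStrategy), ∀ n : ℕ, overhead S true (n + 1) = 0 := by
    refine ae_all_iff.2 fun n => ?_
    have hy : (0 : ℝ) < n + 1 := by positivity
    have h1 := (expectedPayoff_hiderPoint_ge s true hy).trans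
      ((expectedPayoff_le_consistency s hy).trans hC)
    have h2 : 2 * (∫⁻ S, overhead S true (n + 1) ∂(s : Measure PureStrategy)) *
        ENNReal.ofReal (1 / (n + 1)) = 0 := by
      by_contra hne
      exact absurd h1 (not_le.2 (ENNReal.lt_add_right ENNReal.one_ne_top hne))
    have h3 : ENNReal.ofReal (1 / ((n : ℝ) + 1)) ≠ 0 := by simpa using hy
    have h4 : ∫⁻ S, overhead S true (n + 1) ∂(s : Measure PureStrategy) = 0 := by
      simpa [h3, hy.not_ge] using h2
    exact (lintegral_eq_zero_iff (measurable_overhead_left true _)).1 h4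
  obtain ⟨S, hS⟩ := hae.exists
  obtain ⟨n, hn⟩ := exists_nat_gt (S.explored true 0)
  have h1 := ENNReal.tsum_eq_zero.1 (hS n) 0
  rw [if_pos (by linarith), ENNReal.ofReal_eq_zero] at h1
  exact absurd h1 (not_le.2 (S.x_pos 0))

lemma curve_identity {l α : ℝ} (hl : 0 < l) (hα : IsOptimalBase l α) :
    (1 + (1 + √l * α) / Real.log α) + l * (1 + (1 + α / √l) / Real.log α) =
      1 + l + 2 * √l * α := by
  have hm : 0 < √l := Real.sqrt_pos.2 hl
  have hlog : 0 < Real.log α := Real.log_pos hα.1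
  have h := objective_eq_of_stationary hα.1 (hα.stationary hl)
  rw [← h, objective]
  have e : l * (α / √l) = √l * α := by
    rw [mul_div_assoc', div_eq_iff hm.ne']
    linear_combination -α * Real.mul_self_sqrt hl.le
  have e2 : l * ((1 + α / √l) / Real.log α) = (l + √l * α) / Real.log α := by
    rw [← e]; ring
  rw [mul_add, e2]
  ring

lemma optimal_le_consistency_add_robustness {s : MixedStrategy} (hs : robustness s ≠ ⊤) {l α : ℝ}
    (hl : 0 < l) (hl1 : l ≤ 1) (hα : IsOptimalBase l α) :
    (1 + (1 + √l * α) / Real.log α) + l * (1 + (1 + α / √l) / Real.log α) ≤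
      (consistency s).toReal + l * (robustness s).toReal := by
  have hsq := Real.sq_sqrt hl.le
  have h := hα.stationary hl
  have := consistency_add_robustness_ge s hs (Real.sqrt_pos.2 hl)
    (Real.sqrt_le_one.2 hl1) hα.1 (by rw [hsq]; exact h)
  rw [hsq] at this
  rwa [curve_identity hl hα]

theorem paretoOptimal_geometricStrategy {l α : ℝ} (hl : 0 < l) (hl1 : l ≤ 1)
    (hα : IsOptimalBase l α) :
    ParetoOptimal (geometricStrategy α (√l) hα.1 (Real.sqrt_pos.2 hl)) := by
  rintro ⟨s, hC, hR, hlt⟩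
  have hm : 0 < √l := Real.sqrt_pos.2 hl
  have hα0 : 0 < α := by linarith [hα.1]
  have hlog : 0 < Real.log α := Real.log_pos hα.1
  rw [consistency_geometricStrategy] at hC hlt
  rw [robustness_geometricStrategy hα.1 hm (Real.sqrt_le_one.2 hl1)] at hR hlt
  have hsR : robustness s ≠ ⊤ := ne_top_of_le_ne_top ENNReal.ofReal_ne_top hR
  have hsC : consistency s ≠ ⊤ := ne_top_of_le_ne_top ENNReal.ofReal_ne_top hC
  have key := optimal_le_consistency_add_robustness hsR hl hl1 hα
  have hC' := ENNReal.toReal_le_of_le_ofReal (by positivity) hC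
  have hR' := ENNReal.toReal_le_of_le_ofReal (by positivity) hR
  rcases hlt with h | h
  · have := (ENNReal.lt_ofReal_iff_toReal_lt hsC).1 h
    nlinarith
  · have := (ENNReal.lt_ofReal_iff_toReal_lt hsR).1 h
    nlinarith

/-- A Pareto optimal strategy lies on the curve: compare it with the geometric strategy of the same
consistency, or with the unbiased one if its consistency is larger than that. -/
lemma exists_isOptimalBase_of_paretoOptimal {s : MixedStrategy} (hs : ParetoOptimal s) :
    ∃ l α : ℝ, 0 < l ∧ l ≤ 1 ∧ IsOptimalBase l α ∧
      consistency s = ENNReal.ofReal (1 + (1 + √l * α) / Real.log α) ∧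
      robustness s = ENNReal.ofReal (1 + (1 + α / √l) / Real.log α) := by
  -- A strategy that weakly dominates `s` is no better than `s`.
  have hdom : ∀ s' : MixedStrategy, consistency s' ≤ consistency s → robustness s' ≤ robustness s →
      consistency s = consistency s' ∧ robustness s = robustness s' := by
    intro s' h1 h2
    constructor
    · by_contra hne
      exact hs ⟨s', h1, h2, Or.inl (lt_of_le_of_ne h1 (Ne.symm hne))⟩
    · by_contra hne
      exact hs ⟨s', h1, h2, Or.inr (lt_of_le_of_ne h2 (Ne.symm hne))⟩
  obtain ⟨a, ha, -⟩ := existsUnique_isOptimalBase one_pos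
  have ha' := ha.stationary one_pos
  rw [Real.sqrt_one] at ha'
  rcases le_or_gt (ENNReal.ofReal (1 + (1 + a) / Real.log a)) (consistency s) with h | h
  · have hm : 0 < √(1 : ℝ) := by simp
    have hC := consistency_geometricStrategy ha.1 hm
    have hR := robustness_geometricStrategy ha.1 hm (by simp)
    obtain ⟨h1, h2⟩ := hdom (geometricStrategy a (√1) ha.1 hm)
      (hC.le.trans (by simpa using h))
      (hR.le.trans ((le_of_eq (by simp)).trans (h.trans (consistency_le_robustness s))))
    exact ⟨1, a, one_pos, le_rfl, ha, h1.trans hC, h2.trans hR⟩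
  · have hfin : consistency s ≠ ⊤ := h.ne_top
    have hc1 : 1 < (consistency s).toReal := by
      have := (ENNReal.toReal_lt_toReal ENNReal.one_ne_top hfin).2 (one_lt_consistency s)
      simpa using this
    obtain ⟨l, α, hl, hl1, hα, hc⟩ := exists_isOptimalBase_of_consistency ha.1
      (by linarith) hc1 ((ENNReal.lt_ofReal_iff_toReal_lt hfin).1 h).le
    have hm : 0 < √l := Real.sqrt_pos.2 hl
    have hC := consistency_geometricStrategy hα.1 hm
    have hR := robustness_geometricStrategy hα.1 hm (Real.sqrt_le_one.2 hl1)
    have hCs : consistency s = ENNReal.ofReal (1 + (1 + √l * α) / Real.log α) := by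
      rw [hc, ENNReal.ofReal_toReal hfin]
    have hRs : ENNReal.ofReal (1 + (1 + α / √l) / Real.log α) ≤ robustness s := by
      by_cases hsR : robustness s = ⊤
      · rw [hsR]
        exact le_top
      · have key := optimal_le_consistency_add_robustness hsR hl hl1 hα
        rw [hc] at key
        exact ENNReal.ofReal_le_of_le_toReal (le_of_mul_le_mul_left (by linarith) hl)
    obtain ⟨-, h2⟩ := hdom _ (hC.trans hCs.symm).le (hR.le.trans hRs)
    exact ⟨l, α, hl, hl1, hα, hCs, h2.trans hR⟩

end LinearSearch


theorem mainTheorem1 :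
    (∀ l : ℝ, 0 < l → l ≤ 1 → ∃! α : ℝ, LinearSearch.IsOptimalBase l α) ∧
    LinearSearch.paretoFrontier =
      {p : ENNReal × ENNReal | ∃ l α : ℝ, 0 < l ∧ l ≤ 1 ∧ LinearSearch.IsOptimalBase l α ∧
        p = (ENNReal.ofReal (1 + (1 + Real.sqrt l * α) / Real.log α),
             ENNReal.ofReal (1 + (1 + α / Real.sqrt l) / Real.log α))} ∧
    (∀ (l α : ℝ) (hl : 0 < l) (_ : l ≤ 1) (hα : LinearSearch.IsOptimalBase l α),
      LinearSearch.ParetoOptimal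
        (LinearSearch.geometricStrategy α (Real.sqrt l) hα.1 (Real.sqrt_pos.2 hl)) ∧
      LinearSearch.consistency
        (LinearSearch.geometricStrategy α (Real.sqrt l) hα.1 (Real.sqrt_pos.2 hl)) =
          ENNReal.ofReal (1 + (1 + Real.sqrt l * α) / Real.log α) ∧
      LinearSearch.robustness
        (LinearSearch.geometricStrategy α (Real.sqrt l) hα.1 (Real.sqrt_pos.2 hl)) =
          ENNReal.ofReal (1 + (1 + α / Real.sqrt l) / Real.log α)) := by
  have hgeo : ∀ (l α : ℝ) (hl : 0 < l) (_ : l ≤ 1) (hα : LinearSearch.IsOptimalBase l α),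
      LinearSearch.ParetoOptimal
        (LinearSearch.geometricStrategy α (Real.sqrt l) hα.1 (Real.sqrt_pos.2 hl)) ∧
      LinearSearch.consistency
        (LinearSearch.geometricStrategy α (Real.sqrt l) hα.1 (Real.sqrt_pos.2 hl)) =
          ENNReal.ofReal (1 + (1 + Real.sqrt l * α) / Real.log α) ∧
      LinearSearch.robustness
        (LinearSearch.geometricStrategy α (Real.sqrt l) hα.1 (Real.sqrt_pos.2 hl)) =
          ENNReal.ofReal (1 + (1 + α / Real.sqrt l) / Real.log α) := fun l α hl hl1 hα =>
    ⟨LinearSearch.paretoOptimal_geometricStrategy hl hl1 hα,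
      LinearSearch.consistency_geometricStrategy hα.1 (Real.sqrt_pos.2 hl),
      LinearSearch.robustness_geometricStrategy hα.1 (Real.sqrt_pos.2 hl)
        (Real.sqrt_le_one.2 hl1)⟩
  refine ⟨fun l hl _ => LinearSearch.existsUnique_isOptimalBase hl, ?_, hgeo⟩
  · ext p
    constructor
    · rintro ⟨s, hs, rfl⟩
      obtain ⟨l, α, hl, hl1, hα, hC, hR⟩ :=
        LinearSearch.exists_isOptimalBase_of_paretoOptimal hs
      exact ⟨l, α, hl, hl1, hα, by rw [hC, hR]⟩
    · rintro ⟨l, α, hl, hl1, hα, rfl⟩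
      obtain ⟨hP, hC, hR⟩ := hgeo l α hl hl1 hα
      exact ⟨_, hP, by rw [hC, hR]⟩
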